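/- Let $A\in\mathbb R^{m\times n}$ have rows $a_1^\top,\dots,a_m^\top$, and let $G$ be its orthogonality graph: the nodes are $1,\dots,m$, and distinct $i,j$ are joined by an edge iff $\langle a_i,a_j\rangle\neq 0$. Assume that $G$ has at least one edge. For $b\in\mathbb R^m$ such that the solution set $\mathcal S=\{x: Ax=b\}$ is non-empty, let $P_{\mathcal S}$ be the orthogonal projection onto $\mathcal S$ and put $$\sigma(A,\infty)=\inf_{x\notin \mathcal S}\frac{\|A(x-P_{\mathcal S}x)\|_\infty}{\|x-P_{\mathcal S}x\|}$$ (the value is the same for all such $b$). With $[t]_+=\max\{0,t\}$ let $$\rho=\max_{S}\Big(\prod_{j\in S}\Big[1-\frac{\sigma(A,\infty)^2}{\|a_j\|^2}\Big]_+\Big)^{1/|S|},$$ where $S$ runs over (the node sets of) all star subgraphs of $G$ with at least two nodes, that is, a centre together with one or more of its neighbours. Then there is a constant $C>0$ depending only on $A$ such that the following holds for every $b$ for which $Ax=b$ is consistent. Let $(x^k)_{k\ge0}$ be generated from any $x^0\in\mathbb R^n$ by the Kaczmarz method with the maximum residual rule, with arbitrary tie-breaking: $$i_k\in\arg\max_i|a_i^\top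 x^k-b_i|,\qquad x^{k+1}=x^k+\frac{b_{i_k}-a_{i_k}^\top x^k}{\|a_{i_k}\|^2}\,a_{i_k}$$ (if $a_{i_k}=0$, which can happen only when $Ax^k=b$, put $x^{k+1}=x^k$). Let $x^*=P_{\mathcal S}x^0$. Then $$\|x^k-x^*\|^2\le C\,\rho^k\,\|x^0-x^*\|^2$$ for every $k\ge 0$ if $\rho>0$, and for every $k\ge m$ if $\rho=0$ (so that then $x^k=x^*$ for all $k\ge m$). -/

import Mathlib

/-- The `i`-th row `a_i` of `A`, as a vector of Euclidean space. -/
def kaczmarzRow {m n : ℕ} (A : Matrix (Fin m) (Fin n) ℝ) (i : Fin m) :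
    EuclideanSpace ℝ (Fin n) :=
  WithLp.toLp 2 (A i)

/-- The solution set `S` of the linear system `A x = b`. -/
def linSolutions {m n : ℕ} (A : Matrix (Fin m) (Fin n) ℝ) (b : Fin m → ℝ) :
    Set (EuclideanSpace ℝ (Fin n)) :=
  {x | A.mulVec x.ofLp = b}

/-- `p` is the projection of `x` onto `S`: a point of `S` nearest to `x`. -/
def IsProjOnto {n : ℕ} (S : Set (EuclideanSpace ℝ (Fin n)))
    (x p : EuclideanSpace ℝ (Fin n)) : Prop :=
  p ∈ S ∧ ∀ y ∈ S, ‖x - p‖ ≤ ‖x - y‖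

/-- The Hoffman-like constant `σ(A,∞)`: the infimum, over all `x` that do not solve `A x = b`,
of `‖A (x - p)‖_∞ / ‖x - p‖`, where `p` is the projection of `x` onto the solution set.
The norm in the numerator, on `Fin m → ℝ`, is the maximum norm.
(For consistent systems the value is the same for every `b`.) -/
noncomputable def hoffmanInf {m n : ℕ} (A : Matrix (Fin m) (Fin n) ℝ) (b : Fin m → ℝ) : ℝ :=
  sInf {r | ∃ x p : EuclideanSpace ℝ (Fin n), x ∉ linSolutions A b ∧
    IsProjOnto (linSolutions A b) x p ∧ r = ‖A.mulVec (x - p).ofLp‖ / ‖x - p‖}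

/-- The orthogonality graph of `A`: distinct rows are joined when they are not orthogonal. -/
def orthogonalityGraph {m n : ℕ} (A : Matrix (Fin m) (Fin n) ℝ) : SimpleGraph (Fin m) where
  Adj i j := i ≠ j ∧ inner ℝ (kaczmarzRow A i) (kaczmarzRow A j) ≠ 0
  symm := ⟨fun i j h => ⟨h.1.symm, by rw [real_inner_comm]; exact h.2⟩⟩
  loopless := ⟨fun _ h => h.1 rfl⟩

/-- `H` is a star subgraph with at least two nodes: some node `c` of `H` is joined in `H` to all
the other nodes of `H`, and `H` has no further edges. -/
def IsStarSubgraph {V : Type*} {G : SimpleGraph V} (H : G.Subgraph) : Prop :=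
  H.verts.Nontrivial ∧ ∃ c : H.verts, H.coe = SimpleGraph.starGraph c

/-- The factor `1 - σ(A,∞)² / ‖a_j‖²`, read as `0` when it is negative (a row with
`‖a_j‖ < σ(A,∞)` is never the row of maximum residual unless the system is already solved). -/
noncomputable def rowFactor {m n : ℕ} (A : Matrix (Fin m) (Fin n) ℝ) (b : Fin m → ℝ)
    (j : Fin m) : ℝ :=
  max 0 (1 - hoffmanInf A b ^ 2 / ‖kaczmarzRow A j‖ ^ 2)

open Classical in
/-- The geometric mean of the row factors over the nodes of `H`. -/
noncomputable def subgraphGeomMean {m n : ℕ} (A : Matrix (Fin m) (Fin n) ℝ) (b : Fin m → ℝ)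
    (H : (orthogonalityGraph A).Subgraph) : ℝ :=
  (∏ j ∈ Finset.univ.filter (fun j => j ∈ H.verts), rowFactor A b j) ^
    ((H.verts.ncard : ℝ)⁻¹)

/-- The maximum of the geometric means over all star subgraphs with at least two nodes
(a finite set of values, non-empty as soon as the graph has an edge). -/
noncomputable def starRate {m n : ℕ} (A : Matrix (Fin m) (Fin n) ℝ) (b : Fin m → ℝ) : ℝ :=
  sSup {r | ∃ H : (orthogonalityGraph A).Subgraph, IsStarSubgraph H ∧ r = subgraphGeomMean A b H}

/-- `x` is a sequence of Kaczmarz iterates for `A x = b` in which the rows `i k` are selected by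
the maximum residual rule, with ties broken arbitrarily. -/
structure IsMaxResidualKaczmarz {m n : ℕ} (A : Matrix (Fin m) (Fin n) ℝ) (b : Fin m → ℝ)
    (i : ℕ → Fin m) (x : ℕ → EuclideanSpace ℝ (Fin n)) : Prop where
  select : ∀ k j, |inner ℝ (kaczmarzRow A j) (x k) - b j| ≤
    |inner ℝ (kaczmarzRow A (i k)) (x k) - b (i k)|
  step : ∀ k, x (k + 1) = x k +
    ((b (i k) - inner ℝ (kaczmarzRow A (i k)) (x k)) / ‖kaczmarzRow A (i k)‖ ^ 2) •
      kaczmarzRow A (i k)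

/-! Before the system is solved, a step along row `j` multiplies the squared error by at most
`rowFactor A b j` (`norm_succ_sub_sq_le`). It also makes the residual of row `j` vanish, and only a
step along a neighbour can change that; so between two selections of a row some neighbour is
selected (`exists_adj_between`).

Let the parent of a time be the latest earlier time at which a neighbour was selected. Siblings then
carry distinct rows, so a parent with its children is a star of `G`. Peeling off such stars leaves
only root times, which carry distinct rows, hence at most `m` of them
(`exists_injOn_prod_range_le`). Each star contributes at most `ρ` to the power of its size, and the
roots cost at most a factor `ρ⁻ᵐ`. -/

/-! ### Splitting a forest of times into stars. -/

/-- A finite forest whose non-root nodes are joined to a parent, with siblings mapped to distinct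
nodes of `G`, splits into stars and a set of roots. -/
theorem exists_roots_prod_le {V : Type*} [DecidableEq V] (G : SimpleGraph V) (w : V → ℝ) {ρ : ℝ}
    (hw : ∀ v, 0 ≤ w v) (hρ : 0 ≤ ρ)
    (hstar : ∀ (c : V) (L : Finset V), L.Nonempty → (∀ v ∈ L, G.Adj c v) →
      ∏ v ∈ insert c L, w v ≤ ρ ^ (insert c L).card)
    (p : ℕ → ℕ) (f : ℕ → V) (root : ℕ → Prop)
    (hlt : ∀ t, ¬ root t → p t < t) (hadj : ∀ t, ¬ root t → G.Adj (f (p t)) (f t))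
    (T : Finset ℕ) (hp : ∀ t ∈ T, ¬ root t → p t ∈ T)
    (hinj : ∀ s ∈ T, ∀ t ∈ T, ¬ root s → ¬ root t → p s = p t → f s = f t → s = t) :
    ∃ R ⊆ T, (∀ t ∈ R, root t) ∧
      ∏ t ∈ T, w (f t) ≤ ρ ^ (T.card - R.card) * ∏ t ∈ R, w (f t) := by
  classical
  induction T using Finset.strongInduction with
  | H T ih =>
  by_cases hroot : ∀ t ∈ T, root t
  · exact ⟨T, subset_rfl, hroot, by simp⟩
  push Not at hroot
  obtain ⟨t₀, ht₀, hr₀⟩ := hroot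
  -- With the latest possible parent `u`, all children of `u` are leaves, so removing `u` together
  -- with them keeps the rest closed under parents.
  obtain ⟨t₁, ht₁, hmax⟩ := (T.filter (fun t => ¬ root t)).exists_max_image p
    ⟨t₀, by simp [ht₀, hr₀]⟩
  rw [Finset.mem_filter] at ht₁
  set u := p t₁ with hu
  set K := T.filter (fun t => ¬ root t ∧ p t = u) with hK
  have huT : u ∈ T := hp _ ht₁.1 ht₁.2
  have hKm : ∀ t, t ∈ K ↔ t ∈ T ∧ ¬ root t ∧ p t = u := by simp [hK]
  have huK : u ∉ K := fun h => by
    have h' := (hKm u).1 h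
    have := hlt u h'.2.1
    omega
  have hsub : insert u K ⊆ T := by
    intro t ht
    rcases Finset.mem_insert.1 ht with rfl | h
    · exact huT
    · exact ((hKm t).1 h).1
  have hKinj : Set.InjOn f K := fun s hs t ht hst => by
    have h1 := (hKm s).1 hs
    have h2 := (hKm t).1 ht
    exact hinj s h1.1 t h2.1 h1.2.1 h2.2.1 (h1.2.2.trans h2.2.2.symm) hst
  have hadj' : ∀ t ∈ K, G.Adj (f u) (f t) := fun t ht => by
    have h1 := (hKm t).1 ht
    rw [← h1.2.2]
    exact hadj t h1.2.1
  have hfu : f u ∉ K.image f := fun h => by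
    obtain ⟨t, ht, h⟩ := Finset.mem_image.1 h
    exact (hadj' t ht).ne h.symm
  have hS := hstar (f u) (K.image f) ⟨f t₁, Finset.mem_image_of_mem f
    ((hKm t₁).2 ⟨ht₁.1, ht₁.2, rfl⟩)⟩ (by
      intro v hv
      obtain ⟨t, ht, rfl⟩ := Finset.mem_image.1 hv
      exact hadj' t ht)
  rw [Finset.prod_insert hfu, Finset.prod_image hKinj, Finset.card_insert_of_notMem hfu,
    Finset.card_image_of_injOn hKinj, ← Finset.card_insert_of_notMem huK,
    ← Finset.prod_insert (f := fun t => w (f t)) huK] at hS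
  obtain ⟨R, hRT, hR, hle⟩ := ih (T \ insert u K)
    ((Finset.sdiff_ssubset hsub ⟨u, Finset.mem_insert_self _ _⟩))
    (by
      intro t ht hrt
      rw [Finset.mem_sdiff, Finset.mem_insert, not_or] at ht
      rw [Finset.mem_sdiff, Finset.mem_insert, not_or]
      refine ⟨hp t ht.1 hrt, fun h => ht.2.2 ((hKm t).2 ⟨ht.1, hrt, h⟩), fun h => ?_⟩
      have h1 := (hKm _).1 h
      have h2 := hlt _ h1.2.1
      have h3 := hmax t (by simp [ht.1, hrt])
      omega)
    (fun s hs t ht => hinj s (Finset.mem_sdiff.1 hs).1 t (Finset.mem_sdiff.1 ht).1)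
  refine ⟨R, hRT.trans Finset.sdiff_subset, hR, ?_⟩
  have hc1 := Finset.card_le_card hRT
  have hc2 := Finset.card_sdiff_add_card_eq_card hsub
  have hc : T.card - R.card = (T \ insert u K).card - R.card + (insert u K).card := by omega
  rw [← Finset.prod_sdiff hsub, hc, pow_add]
  calc _ ≤ (ρ ^ ((T \ insert u K).card - R.card) * ∏ t ∈ R, w (f t)) * ρ ^ (insert u K).card :=
        mul_le_mul hle hS (Finset.prod_nonneg fun t _ => hw _)
          (mul_nonneg (pow_nonneg hρ _) (Finset.prod_nonneg fun t _ => hw _))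
    _ = _ := by ring

/-- If between any two visits of `f` to a node there is a visit to one of its neighbours, then the
product of the weights along `f` is governed by the stars, up to a set of times on which `f` is
injective. -/
theorem exists_injOn_prod_range_le {V : Type*} [DecidableEq V] (G : SimpleGraph V) (w : V → ℝ)
    {ρ : ℝ} (hw : ∀ v, 0 ≤ w v) (hρ : 0 ≤ ρ)
    (hstar : ∀ (c : V) (L : Finset V), L.Nonempty → (∀ v ∈ L, G.Adj c v) →
      ∏ v ∈ insert c L, w v ≤ ρ ^ (insert c L).card)
    (f : ℕ → V) (k : ℕ)
    (hf : ∀ s t, s < t → t < k → f s = f t → ∃ r, s < r ∧ r < t ∧ G.Adj (f r) (f t)) :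
    ∃ R ⊆ Finset.range k, Set.InjOn f R ∧
      ∏ t ∈ Finset.range k, w (f t) ≤ ρ ^ (k - R.card) * ∏ t ∈ R, w (f t) := by
  classical
  -- The value `0` for times without an earlier neighbour is a dummy: those are the roots.
  have hpar : ∀ t, ∃ u, (∃ s < t, G.Adj (f s) (f t)) →
      u < t ∧ G.Adj (f u) (f t) ∧ ∀ r < t, G.Adj (f r) (f t) → r ≤ u := by
    intro t
    by_cases h : ∃ s < t, G.Adj (f s) (f t)
    · obtain ⟨s, hs, hst⟩ := h
      obtain ⟨u, hu, hmax⟩ := ((Finset.range t).filter (fun r => G.Adj (f r) (f t))).exists_max_image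
        id ⟨s, by simp [hs, hst]⟩
      simp only [Finset.mem_filter, Finset.mem_range, id] at hu hmax
      exact ⟨u, fun _ => ⟨hu.1, hu.2, fun r hr hrt => hmax r ⟨hr, hrt⟩⟩⟩
    · exact ⟨0, fun h' => absurd h' h⟩
  choose p hp using hpar
  obtain ⟨R, hRT, hR, hle⟩ := exists_roots_prod_le G w hw hρ hstar p f
    (fun t => ¬ ∃ s < t, G.Adj (f s) (f t)) (fun t ht => (hp t (not_not.1 ht)).1)
    (fun t ht => (hp t (not_not.1 ht)).2.1) (Finset.range k)
    (fun t ht hr => Finset.mem_range.2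
      ((hp t (not_not.1 hr)).1.trans (Finset.mem_range.1 ht))) (by
      intro s hs t ht hrs hrt hpp hst
      rw [not_not] at hrs hrt
      rw [Finset.mem_range] at hs ht
      have h1 := hp s hrs
      have h2 := hp t hrt
      rcases lt_trichotomy s t with h | h | h
      · obtain ⟨r, hr1, hr2, hr3⟩ := hf s t h ht hst
        have := h2.2.2 r hr2 hr3
        omega
      · exact h
      · obtain ⟨r, hr1, hr2, hr3⟩ := hf t s h hs hst.symm
        have := h1.2.2 r hr2 hr3
        omega)
  refine ⟨R, hRT, ?_, by simpa using hle⟩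
  intro s hs t ht hst
  have hs' := Finset.mem_range.1 (hRT hs)
  have ht' := Finset.mem_range.1 (hRT ht)
  rcases lt_trichotomy s t with h | h | h
  · obtain ⟨r, -, hr2, hr3⟩ := hf s t h ht' hst
    exact absurd ⟨r, hr2, hr3⟩ (hR t ht)
  · exact h
  · obtain ⟨r, -, hr2, hr3⟩ := hf t s h hs' hst.symm
    exact absurd ⟨r, hr2, hr3⟩ (hR s hs)

/-! ### Row factors and the star rate. -/

theorem rowFactor_nonneg {m n : ℕ} (A : Matrix (Fin m) (Fin n) ℝ) (b : Fin m → ℝ) (j : Fin m) :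
    0 ≤ rowFactor A b j :=
  le_max_left _ _

theorem rowFactor_le_one {m n : ℕ} (A : Matrix (Fin m) (Fin n) ℝ) (b : Fin m → ℝ) (j : Fin m) :
    rowFactor A b j ≤ 1 :=
  max_le zero_le_one (sub_le_self _ (by positivity))

theorem subgraphGeomMean_nonneg {m n : ℕ} (A : Matrix (Fin m) (Fin n) ℝ) (b : Fin m → ℝ)
    (H : (orthogonalityGraph A).Subgraph) : 0 ≤ subgraphGeomMean A b H :=
  Real.rpow_nonneg (Finset.prod_nonneg fun j _ => rowFactor_nonneg A b j) _

theorem subgraphGeomMean_le_one {m n : ℕ} (A : Matrix (Fin m) (Fin n) ℝ) (b : Fin m → ℝ)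
    (H : (orthogonalityGraph A).Subgraph) : subgraphGeomMean A b H ≤ 1 :=
  Real.rpow_le_one (Finset.prod_nonneg fun j _ => rowFactor_nonneg A b j)
    (Finset.prod_le_one (fun j _ => rowFactor_nonneg A b j) fun j _ => rowFactor_le_one A b j)
    (by positivity)

theorem starRate_nonneg {m n : ℕ} (A : Matrix (Fin m) (Fin n) ℝ) (b : Fin m → ℝ) :
    0 ≤ starRate A b :=
  Real.sSup_nonneg (by rintro _ ⟨H, -, rfl⟩; exact subgraphGeomMean_nonneg A b H)

theorem starRate_le_one {m n : ℕ} (A : Matrix (Fin m) (Fin n) ℝ) (b : Fin m → ℝ) :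
    starRate A b ≤ 1 :=
  Real.sSup_le (by rintro _ ⟨H, -, rfl⟩; exact subgraphGeomMean_le_one A b H) zero_le_one

theorem subgraphGeomMean_le_starRate {m n : ℕ} (A : Matrix (Fin m) (Fin n) ℝ) (b : Fin m → ℝ)
    {H : (orthogonalityGraph A).Subgraph} (hH : IsStarSubgraph H) :
    subgraphGeomMean A b H ≤ starRate A b :=
  le_csSup ⟨1, by rintro _ ⟨H, -, rfl⟩; exact subgraphGeomMean_le_one A b H⟩ ⟨H, hH, rfl⟩

/-- This puts the bound on geometric means into the product form needed for peeling; the subgraph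
`H` has exactly the edges from `c` to `L`. -/
theorem prod_rowFactor_le_starRate_pow {m n : ℕ} (A : Matrix (Fin m) (Fin n) ℝ) (b : Fin m → ℝ)
    (c : Fin m) (L : Finset (Fin m)) (hL : L.Nonempty)
    (hadj : ∀ v ∈ L, (orthogonalityGraph A).Adj c v) :
    ∏ v ∈ insert c L, rowFactor A b v ≤ starRate A b ^ (insert c L).card := by
  classical
  have hcL : c ∉ L := fun h => (hadj c h).ne rfl
  let H : (orthogonalityGraph A).Subgraph :=
    { verts := ↑(insert c L)
      Adj := fun u v => (u = c ∧ v ∈ L) ∨ (v = c ∧ u ∈ L)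
      adj_sub := by
        rintro u v (⟨rfl, h⟩ | ⟨rfl, h⟩)
        · exact hadj v h
        · exact (hadj u h).symm
      edge_vert := by
        rintro u v (⟨rfl, h⟩ | ⟨rfl, h⟩) <;> simp [h]
      symm := ⟨fun u v h => h.symm⟩ }
  have hH : IsStarSubgraph H := by
    obtain ⟨v, hv⟩ := hL
    refine ⟨⟨c, by simp [H], v, by simp [H, hv], (hadj v hv).ne⟩, ⟨c, by simp [H]⟩, ?_⟩
    ext ⟨x, hx⟩ ⟨y, hy⟩
    simp only [H, Finset.coe_insert, Set.mem_insert_iff, Finset.mem_coe] at hx hy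
    simp only [SimpleGraph.starGraph_adj, SimpleGraph.Subgraph.coe_adj, H, Subtype.mk.injEq, ne_eq]
    grind
  have h := subgraphGeomMean_le_starRate A b hH
  have hcard : H.verts.ncard = (insert c L).card := Set.ncard_coe_finset _
  have hprod : ∏ j ∈ Finset.univ.filter (fun j => j ∈ H.verts), rowFactor A b j =
      ∏ v ∈ insert c L, rowFactor A b v :=
    Finset.prod_congr (by ext j; simp [H]) fun _ _ => rfl
  have hne : (insert c L).card ≠ 0 := by simp
  have h0 : 0 ≤ ∏ v ∈ insert c L, rowFactor A b v :=
    Finset.prod_nonneg fun j _ => rowFactor_nonneg A b j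
  unfold subgraphGeomMean at h
  rw [hcard] at h
  have h' : (∏ v ∈ insert c L, rowFactor A b v) ^ (((insert c L).card : ℝ)⁻¹) ≤ starRate A b := by
    convert h using 2
    rw [← hprod]
    congr!
  calc _ = ((∏ v ∈ insert c L, rowFactor A b v) ^ (((insert c L).card : ℝ)⁻¹)) ^
        (insert c L).card := (Real.rpow_inv_natCast_pow h0 hne).symm
    _ ≤ _ := pow_le_pow_left₀ (Real.rpow_nonneg h0 _) h' _

/-! ### Projections onto the solution set and the constant `σ(A,∞)`. -/

theorem inner_kaczmarzRow {m n : ℕ} (A : Matrix (Fin m) (Fin n) ℝ) (i : Fin m)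
    (x : EuclideanSpace ℝ (Fin n)) : inner ℝ (kaczmarzRow A i) x = A.mulVec x.ofLp i := by
  rw [EuclideanSpace.inner_eq_star_dotProduct, dotProduct_comm]
  simp [kaczmarzRow, Matrix.mulVec]

theorem mem_linSolutions_iff {m n : ℕ} {A : Matrix (Fin m) (Fin n) ℝ} {b : Fin m → ℝ}
    {x : EuclideanSpace ℝ (Fin n)} :
    x ∈ linSolutions A b ↔ ∀ j, inner ℝ (kaczmarzRow A j) x = b j := by
  simp only [inner_kaczmarzRow]
  exact funext_iff

theorem IsProjOnto.inner_sub_eq_zero {m n : ℕ} {A : Matrix (Fin m) (Fin n) ℝ} {b : Fin m → ℝ}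
    {x p v : EuclideanSpace ℝ (Fin n)} (h : IsProjOnto (linSolutions A b) x p)
    (hv : v ∈ linSolutions A 0) : inner ℝ (x - p) v = 0 := by
  by_contra hq
  have hv0 : 0 < ‖v‖ := norm_pos_iff.2 (by rintro rfl; simp at hq)
  -- This `t` minimises the distance from `x` along the line `p + t • v`.
  set t : ℝ := inner ℝ (x - p) v / ‖v‖ ^ 2 with ht
  have hmem : p + t • v ∈ linSolutions A b := by
    have h1 := h.1
    rw [mem_linSolutions_iff] at h1 hv ⊢
    intro j
    rw [inner_add_right, inner_smul_right, h1 j, hv j]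
    simp
  have h1 := pow_le_pow_left₀ (norm_nonneg _) (h.2 _ hmem) 2
  rw [← sub_sub, norm_sub_sq_real (x - p) (t • v), inner_smul_right, norm_smul, mul_pow,
    Real.norm_eq_abs, sq_abs] at h1
  have h2 : t * ‖v‖ ^ 2 = inner ℝ (x - p) v := by rw [ht]; field_simp
  have h3 : 0 < t * inner ℝ (x - p) v := by
    rw [ht, div_mul_eq_mul_div, ← sq]
    exact div_pos (sq_pos_of_ne_zero hq) (pow_pos hv0 2)
  rw [sq t, mul_assoc, h2] at h1
  linarith

theorem isProjOnto_linSolutions {m n : ℕ} {A : Matrix (Fin m) (Fin n) ℝ} {b : Fin m → ℝ}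
    {x p : EuclideanSpace ℝ (Fin n)} (hp : p ∈ linSolutions A b)
    (h : ∀ v ∈ linSolutions A 0, inner ℝ (x - p) v = 0) :
    IsProjOnto (linSolutions A b) x p := by
  refine ⟨hp, fun y hy => ?_⟩
  have hv : p - y ∈ linSolutions A 0 := by
    rw [mem_linSolutions_iff] at hp hy ⊢
    intro j
    rw [inner_sub_right, hp j, hy j]
    simp
  refine le_of_sq_le_sq ?_ (norm_nonneg _)
  rw [← sub_add_sub_cancel x p y, norm_add_sq_real, h _ hv]
  nlinarith [sq_nonneg ‖p - y‖]

/-- Translation by `z` carries the homogeneous problem to the one for `b`. This is what makes the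
final constant independent of `b`. -/
theorem hoffmanInf_eq_of_mem {m n : ℕ} {A : Matrix (Fin m) (Fin n) ℝ} {b : Fin m → ℝ}
    {z : EuclideanSpace ℝ (Fin n)} (hz : z ∈ linSolutions A b) :
    hoffmanInf A b = hoffmanInf A 0 := by
  have key : ∀ x, x + z ∈ linSolutions A b ↔ x ∈ linSolutions A 0 := fun x => by
    rw [mem_linSolutions_iff] at hz
    simp only [mem_linSolutions_iff, inner_add_right, hz, Pi.zero_apply, add_eq_right]
  have key' : ∀ x p, IsProjOnto (linSolutions A b) (x + z) (p + z) ↔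
      IsProjOnto (linSolutions A 0) x p := fun x p => by
    unfold IsProjOnto
    rw [key, ← (Equiv.addRight z).forall_congr_right]
    simp [key]
  unfold hoffmanInf
  congr 1
  ext r
  constructor
  · rintro ⟨x, p, hx, hp, rfl⟩
    refine ⟨x - z, p - z, ?_, ?_, ?_⟩
    · rwa [← key, sub_add_cancel]
    · rwa [← key', sub_add_cancel, sub_add_cancel]
    · rw [sub_sub_sub_cancel_right]
  · rintro ⟨x, p, hx, hp, rfl⟩
    refine ⟨x + z, p + z, ?_, ?_, ?_⟩
    · rwa [key]
    · rwa [key']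
    · rw [add_sub_add_right_eq_sub]

theorem starRate_eq_of_mem {m n : ℕ} {A : Matrix (Fin m) (Fin n) ℝ} {b : Fin m → ℝ}
    {z : EuclideanSpace ℝ (Fin n)} (hz : z ∈ linSolutions A b) : starRate A b = starRate A 0 := by
  simp only [starRate, subgraphGeomMean, rowFactor, hoffmanInf_eq_of_mem hz]

theorem hoffmanInf_nonneg {m n : ℕ} (A : Matrix (Fin m) (Fin n) ℝ) (b : Fin m → ℝ) :
    0 ≤ hoffmanInf A b :=
  Real.sInf_nonneg (by rintro _ ⟨x, p, -, -, rfl⟩; positivity)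

theorem hoffmanInf_mul_norm_le {m n : ℕ} {A : Matrix (Fin m) (Fin n) ℝ} {b : Fin m → ℝ}
    {x p : EuclideanSpace ℝ (Fin n)} (hp : IsProjOnto (linSolutions A b) x p)
    (hx : x ∉ linSolutions A b) :
    hoffmanInf A b * ‖x - p‖ ≤ ‖A.mulVec (x - p).ofLp‖ := by
  have hne : 0 < ‖x - p‖ := norm_pos_iff.2 (sub_ne_zero.2 (by rintro rfl; exact hx hp.1))
  rw [← le_div_iff₀ hne]
  exact csInf_le ⟨0, by rintro _ ⟨x, p, -, -, rfl⟩; positivity⟩ ⟨x, p, hx, hp, rfl⟩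

/-! ### The Kaczmarz iteration. -/

namespace IsMaxResidualKaczmarz

variable {m n : ℕ} {A : Matrix (Fin m) (Fin n) ℝ} {b : Fin m → ℝ} {i : ℕ → Fin m}
  {x : ℕ → EuclideanSpace ℝ (Fin n)} {xstar : EuclideanSpace ℝ (Fin n)}

/-- Each step moves along a row, hence orthogonally to the kernel of `A`, so the projection never
changes. -/
theorem isProjOnto (h : IsMaxResidualKaczmarz A b i x)
    (hp : IsProjOnto (linSolutions A b) (x 0) xstar) (k : ℕ) :
    IsProjOnto (linSolutions A b) (x k) xstar := by
  induction k with
  | zero => exact hp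
  | succ k ih =>
    refine isProjOnto_linSolutions hp.1 fun v hv => ?_
    rw [h.step, add_sub_right_comm, inner_add_left, ih.inner_sub_eq_zero hv, inner_smul_left,
      mem_linSolutions_iff.1 hv]
    simp

theorem eq_of_mem (h : IsMaxResidualKaczmarz A b i x)
    (hp : IsProjOnto (linSolutions A b) (x 0) xstar) {k : ℕ} (hk : x k ∈ linSolutions A b) :
    x k = xstar := by
  have h1 := (h.isProjOnto hp k).2 _ hk
  rw [sub_self, norm_zero] at h1
  exact sub_eq_zero.1 (norm_le_zero_iff.1 h1)

theorem mem_of_residual_eq_zero (h : IsMaxResidualKaczmarz A b i x) {k : ℕ}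
    (hk : inner ℝ (kaczmarzRow A (i k)) (x k) = b (i k)) : x k ∈ linSolutions A b := by
  refine mem_linSolutions_iff.2 fun j => ?_
  have := h.select k j
  rw [hk, sub_self, abs_zero] at this
  exact sub_eq_zero.1 (abs_nonpos_iff.1 this)

theorem succ_eq_of_mem (h : IsMaxResidualKaczmarz A b i x) {k : ℕ}
    (hk : x k ∈ linSolutions A b) : x (k + 1) = x k := by
  rw [h.step, mem_linSolutions_iff.1 hk]
  simp

theorem eq_of_mem_of_le (h : IsMaxResidualKaczmarz A b i x) {s t : ℕ} (hst : s ≤ t)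
    (hs : x s ∈ linSolutions A b) : x t = x s := by
  induction t, hst using Nat.le_induction with
  | base => rfl
  | succ t _ ih => rw [h.succ_eq_of_mem (by rwa [ih]), ih]

theorem kaczmarzRow_ne_zero (h : IsMaxResidualKaczmarz A b i x)
    (hp : xstar ∈ linSolutions A b) {k : ℕ} (hk : x k ∉ linSolutions A b) :
    kaczmarzRow A (i k) ≠ 0 := fun h0 => hk <| h.mem_of_residual_eq_zero <| by
  rw [← mem_linSolutions_iff.1 hp, h0, inner_zero_left, inner_zero_left]

/-- One step of the method contracts the squared error by the factor of the selected row. -/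
theorem norm_succ_sub_sq_le (h : IsMaxResidualKaczmarz A b i x)
    (hp : IsProjOnto (linSolutions A b) (x 0) xstar) {k : ℕ} (hk : x k ∉ linSolutions A b) :
    ‖x (k + 1) - xstar‖ ^ 2 ≤ rowFactor A b (i k) * ‖x k - xstar‖ ^ 2 := by
  set a := kaczmarzRow A (i k) with ha
  have ha0 : 0 < ‖a‖ := norm_pos_iff.2 (h.kaczmarzRow_ne_zero hp.1 hk)
  have hres : ∀ j, inner ℝ (kaczmarzRow A j) (x k - xstar) =
      inner ℝ (kaczmarzRow A j) (x k) - b j := fun j => by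
    rw [inner_sub_right, mem_linSolutions_iff.1 hp.1]
  set r : ℝ := inner ℝ a (x k) - b (i k) with hr
  have hnorm : ‖A.mulVec (x k - xstar).ofLp‖ ≤ |r| :=
    (pi_norm_le_iff_of_nonneg (abs_nonneg _)).2 fun j => by
      rw [← inner_kaczmarzRow, hres, Real.norm_eq_abs]
      exact h.select k j
  have h1 := (hoffmanInf_mul_norm_le (h.isProjOnto hp k) hk).trans hnorm
  have h2 := pow_le_pow_left₀ (mul_nonneg (hoffmanInf_nonneg A b) (norm_nonneg _)) h1 2
  rw [sq_abs, mul_pow] at h2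
  have h3 : ‖x (k + 1) - xstar‖ ^ 2 = ‖x k - xstar‖ ^ 2 - r ^ 2 / ‖a‖ ^ 2 := by
    rw [h.step, add_sub_right_comm, norm_add_sq_real, inner_smul_right,
      real_inner_comm (kaczmarzRow A (i k)) (x k - xstar), hres,
      norm_smul, mul_pow, Real.norm_eq_abs, sq_abs, ← ha, ← hr,
      ← neg_sub (inner ℝ a (x k)) (b (i k)), ← hr]
    field_simp
    ring
  calc ‖x (k + 1) - xstar‖ ^ 2 = ‖x k - xstar‖ ^ 2 - r ^ 2 / ‖a‖ ^ 2 := h3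
    _ ≤ ‖x k - xstar‖ ^ 2 - hoffmanInf A b ^ 2 * ‖x k - xstar‖ ^ 2 / ‖a‖ ^ 2 := by gcongr
    _ = (1 - hoffmanInf A b ^ 2 / ‖a‖ ^ 2) * ‖x k - xstar‖ ^ 2 := by ring
    _ ≤ _ := by
      gcongr
      exact le_max_right _ _

theorem norm_sub_sq_le_prod (h : IsMaxResidualKaczmarz A b i x)
    (hp : IsProjOnto (linSolutions A b) (x 0) xstar) (k : ℕ)
    (hk : ∀ t < k, x t ∉ linSolutions A b) :
    ‖x k - xstar‖ ^ 2 ≤ (∏ t ∈ Finset.range k, rowFactor A b (i t)) * ‖x 0 - xstar‖ ^ 2 := by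
  induction k with
  | zero => simp
  | succ k ih =>
    rw [Finset.prod_range_succ, mul_comm _ (rowFactor A b (i k)), mul_assoc]
    exact (h.norm_succ_sub_sq_le hp (hk k k.lt_succ_self)).trans
      (mul_le_mul_of_nonneg_left (ih fun t ht => hk t (ht.trans k.lt_succ_self))
        (rowFactor_nonneg A b _))

/-- Before convergence, a row is selected again only after one of its neighbours. -/
theorem exists_adj_between (h : IsMaxResidualKaczmarz A b i x)
    (hp : xstar ∈ linSolutions A b) {s t : ℕ} (hst : s < t) (ht : x t ∉ linSolutions A b)
    (hi : i s = i t) : ∃ r, s < r ∧ r < t ∧ (orthogonalityGraph A).Adj (i r) (i t) := by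
  by_contra! hno
  have hs : x s ∉ linSolutions A b := fun hs => ht (by rwa [h.eq_of_mem_of_le hst.le hs])
  have ha : ‖kaczmarzRow A (i s)‖ ≠ 0 := norm_ne_zero_iff.2 (h.kaczmarzRow_ne_zero hp hs)
  have hstep : ∀ r, inner ℝ (kaczmarzRow A (i r)) (kaczmarzRow A (i t)) = 0 →
      inner ℝ (kaczmarzRow A (i t)) (x (r + 1)) = inner ℝ (kaczmarzRow A (i t)) (x r) := by
    intro r hr
    rw [h.step, inner_add_right, inner_smul_right, real_inner_comm (kaczmarzRow A (i r)) (kaczmarzRow A (i t)), hr]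
    simp
  have hself : ∀ r, i r = i s → inner ℝ (kaczmarzRow A (i t)) (x (r + 1)) = b (i t) := by
    intro r hr
    rw [h.step, inner_add_right, inner_smul_right, hr, ← hi, real_inner_self_eq_norm_sq]
    field_simp
    ring
  refine ht (h.mem_of_residual_eq_zero ?_)
  -- The residual of row `i t` vanishes from time `s + 1` on: orthogonal rows leave it alone, and
  -- the same row, which is not its own neighbour, resets it to zero.
  have hall : ∀ r, s + 1 ≤ r → r ≤ t → inner ℝ (kaczmarzRow A (i t)) (x r) = b (i t) := by
    intro r hr
    induction r, hr using Nat.le_induction with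
    | base => exact fun _ => hself s rfl
    | succ r hr ih =>
      intro hrt
      by_cases hrs : i r = i s
      · exact hself r hrs
      · rw [hstep r, ih (by omega)]
        by_contra hne
        exact hno r (by omega) (by omega) ⟨hi ▸ hrs, hne⟩
  exact hall t hst le_rfl

end IsMaxResidualKaczmarz

/-! ### The convergence rate. -/

theorem mainTheorem5 {m n : ℕ} (A : Matrix (Fin m) (Fin n) ℝ)
    (hE : ∃ u v, (orthogonalityGraph A).Adj u v) :
    ∃ C : ℝ, 0 < C ∧
      ∀ (b : Fin m → ℝ) (i : ℕ → Fin m) (x : ℕ → EuclideanSpace ℝ (Fin n))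
        (xstar : EuclideanSpace ℝ (Fin n)),
        IsMaxResidualKaczmarz A b i x → IsProjOnto (linSolutions A b) (x 0) xstar →
        ∀ k : ℕ, (0 < starRate A b ∨ m ≤ k) →
          ‖x k - xstar‖ ^ 2 ≤ C * starRate A b ^ k * ‖x 0 - xstar‖ ^ 2 := by
  classical
  -- Taking the rate at `b = 0` makes the constant depend on `A` alone.
  refine ⟨if 0 < starRate A 0 then (starRate A 0 ^ m)⁻¹ else 1, by split_ifs <;> positivity, ?_⟩
  intro b i x xstar h hp k hk
  rw [← starRate_eq_of_mem hp.1]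
  set ρ := starRate A b with hρ
  have hρ0 : 0 ≤ ρ := starRate_nonneg A b
  have hρ1 : ρ ≤ 1 := starRate_le_one A b
  set C : ℝ := if 0 < ρ then (ρ ^ m)⁻¹ else 1 with hC
  have hC0 : 0 < C := by rw [hC]; split_ifs <;> positivity
  by_cases hxk : ∃ t < k, x t ∈ linSolutions A b
  · obtain ⟨t, htk, ht⟩ := hxk
    rw [h.eq_of_mem_of_le htk.le ht, h.eq_of_mem hp ht, sub_self, norm_zero, zero_pow two_ne_zero]
    positivity
  push Not at hxk
  refine (h.norm_sub_sq_le_prod hp k hxk).trans (mul_le_mul_of_nonneg_right ?_ (sq_nonneg _))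
  obtain ⟨R, hRk, hinj, hle⟩ := exists_injOn_prod_range_le (orthogonalityGraph A)
    (rowFactor A b) (rowFactor_nonneg A b) hρ0 (prod_rowFactor_le_starRate_pow A b) i k
    (fun s t hst htk hi => h.exists_adj_between hp.1 hst (hxk t htk) hi)
  refine hle.trans ?_
  have hRm : R.card ≤ m := by
    simpa using Finset.card_le_card_of_injOn i (fun _ _ => Finset.mem_univ _) hinj
  have hRk' : R.card ≤ k := by simpa using Finset.card_le_card hRk
  by_cases hpos : 0 < ρ
  · rw [hC, if_pos hpos]
    calc ρ ^ (k - R.card) * ∏ t ∈ R, rowFactor A b (i t) ≤ ρ ^ (k - R.card) * 1 := by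
          gcongr
          exact Finset.prod_le_one (fun t _ => rowFactor_nonneg A b _)
            fun t _ => rowFactor_le_one A b _
      _ = (ρ ^ R.card)⁻¹ * ρ ^ k := by
          rw [pow_sub₀ _ hpos.ne' hRk']
          ring
      _ ≤ (ρ ^ m)⁻¹ * ρ ^ k := by
          have := pow_le_pow_of_le_one hρ0 hρ1 hRm
          gcongr
  · have hzero : ρ = 0 := le_antisymm (not_lt.1 hpos) hρ0
    have hmk : m ≤ k := hk.resolve_left hpos
    have hrhs : 0 ≤ C * ρ ^ k := by positivity
    refine le_trans (le_of_eq ?_) hrhs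
    -- For `ρ = 0`, either a star was peeled off and contributes zero, or all `k ≥ m` times are
    -- roots. These then visit every row, including one of factor zero, which exists because the
    -- star on an edge has product zero.
    by_cases hlt : R.card < k
    · rw [hzero, zero_pow (by omega), zero_mul]
    · obtain ⟨u, v, huv⟩ := hE
      have hstar := prod_rowFactor_le_starRate_pow A b u {v} (by simp) (by simpa using huv)
      rw [← hρ, hzero, zero_pow (by simp)] at hstar
      obtain ⟨j, -, hj⟩ := Finset.prod_eq_zero_iff.1
        (le_antisymm hstar (Finset.prod_nonneg fun j _ => rowFactor_nonneg A b j))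
      have himage : R.image i = Finset.univ :=
        Finset.eq_univ_of_card _ (by rw [Finset.card_image_of_injOn hinj, Fintype.card_fin]; omega)
      obtain ⟨t, ht, rfl⟩ := Finset.mem_image.1 (himage ▸ Finset.mem_univ j)
      rw [Finset.prod_eq_zero ht hj, mul_zero]
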